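/- Let $0<\beta<1$, $s:=1-\beta/2\in(\tfrac12,1)$, $a_0,a_1\in\mathbb R$, and let $f\in L^2(0,1)$ satisfy $\int_0^1 f\,dx+a_1-a_0=0$. For $\alpha>0$ let $${}_0I_x^{\alpha}w(x)=\frac1{\Gamma(\alpha)}\int_0^x\frac{w(t)}{(x-t)^{1-\alpha}}\,dt,\qquad {}_xI_1^{\alpha}w(x)=\frac1{\Gamma(\alpha)}\int_x^1\frac{w(t)}{(t-x)^{1-\alpha}}\,dt .$$ The Caputo derivatives of order $s$ are ${}^C_0D_x^{s}v={}_0I_x^{1-s}Dv$ and ${}^C_xD_1^{s}v=-\,{}_xI_1^{1-s}Dv$, understood weakly: $g\in L^2(0,1)$ equals ${}^C_0D_x^sv$ (respectively ${}^C_xD_1^sv$) if for all $\varphi\in C_0^\infty(0,1)$ $$\int_0^1 g\;{}_xI_1^{s}(-\varphi')\,dx=-\int_0^1 v\,\varphi'\,dx\qquad\Big(\text{respectively }\int_0^1 g\;{}_0I_x^{s}\varphi'\,dx=\int_0^1 v\,\varphi'\,dx\Big).$$ Let $H^{s}_{C,l}(0,1)$ be the space of all $v\in L^2(0,1)$ with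 ${}^C_0D_x^{s}v\in L^2(0,1)$. Its elements have a continuous representative on $[0,1]$, with which point values are taken, and have ${}^C_xD_1^{s}v\in L^2(0,1)$. Let $u\in H^{1-\beta/2}_{C,l}(0,1)$ be any weak solution of the conservative Caputo equation $-D({}^C_0D_x^{1-\beta}u)=f$ on $(0,1)$ with Caputo Neumann data $a_0,a_1$, i.e. $$-\int_0^1 {}^C_0D_x^{1-\beta/2}u\;\,{}^C_xD_1^{1-\beta/2}v\,dx=\int_0^1 f v\,dx+a_1v(1)-a_0v(0)\qquad\text{for all }v\in H^{1-\beta/2}_{C,l}(0,1).$$ Then, for the continuous representative of $u$, $$u(x)={}_0I_x^{1-\beta}w(x)+u(0)\qquad\text{for all }x\in[0,1],$$ where $w\in H^1(0,1)$ is the unique weak solution of the Dirichlet problem $-D^2w=Df$ on $(0,1)$, $w(0)=a_0$, $w(1)=a_1$ (that is, $\int_0^1 w'\varphi'\,dx=-\int_0^1 f\varphi'\,dx$ for all $\varphi\in C_0^\infty(0,1)$, with the stated boundary values). -/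

import Mathlib

open MeasureTheory Set
open scoped ContDiff

noncomputable section

namespace CaputoNeumann

/-- Lebesgue measure on the open unit interval. -/
def vol01 : Measure ℝ := volume.restrict (Ioo (0 : ℝ) 1)

/-- The left fractional integral of order `α`,
`(1 / Γ(α)) ∫₀ˣ w(s) (x - s)^(α - 1) ds`. -/
def leftFracInt (α : ℝ) (w : ℝ → ℝ) (x : ℝ) : ℝ :=
  1 / Real.Gamma α * ∫ s in (0 : ℝ)..x, w s / (x - s) ^ (1 - α)

/-- The right fractional integral of order `α`,
`(1 / Γ(α)) ∫ₓ¹ w(s) (s - x)^(α - 1) ds`. -/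
def rightFracInt (α : ℝ) (w : ℝ → ℝ) (x : ℝ) : ℝ :=
  1 / Real.Gamma α * ∫ s in x..(1 : ℝ), w s / (s - x) ^ (1 - α)

/-- The classical left Caputo derivative of order `γ ∈ (0,1)` of a smooth function:
the left fractional integral of order `1 - γ` of `φ'`. -/
def leftCaputo (γ : ℝ) (φ : ℝ → ℝ) : ℝ → ℝ :=
  leftFracInt (1 - γ) (deriv φ)

/-- The classical right Caputo derivative of order `γ ∈ (0,1)` of a smooth function:
the right fractional integral of order `1 - γ` of `-φ'`. -/
def rightCaputo (γ : ℝ) (φ : ℝ → ℝ) : ℝ → ℝ :=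
  rightFracInt (1 - γ) (fun s => -deriv φ s)

/-- `φ ∈ C₀^∞(0,1)`. -/
structure IsTestFunction (φ : ℝ → ℝ) : Prop where
  smooth : ContDiff ℝ ∞ φ
  compact : HasCompactSupport φ
  support : tsupport φ ⊆ Ioo (0 : ℝ) 1

/-- `g ∈ L²(0,1)` is the left Caputo derivative `I^(1-μ) D v` (`I` the left fractional
integral, `D` the weak derivative) of `v`, of order `μ`.  Every test function `φ` is the right
fractional integral of order `1 - μ` of its right Caputo derivative of order `1 - μ`, so that
the adjointness of the left and right fractional integrals turns `g = I^(1-μ) D v` into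
`∫ g (right Caputo derivative of φ) = ⟨D v, φ⟩ = - ∫ v φ'`.
For `1/2 < μ < 1` the function `g` is determined by `v` almost everywhere. -/
structure HasLeftCaputoDeriv (μ : ℝ) (v g : ℝ → ℝ) : Prop where
  memLp : MemLp g 2 vol01
  weak : ∀ φ : ℝ → ℝ, IsTestFunction φ →
    ∫ x, g x * rightCaputo (1 - μ) φ x ∂vol01 = -∫ x, v x * deriv φ x ∂vol01

/-- `h ∈ L²(0,1)` is the right Caputo derivative `I^(1-μ) (-D v)` (`I` the right fractional
integral, `D` the weak derivative) of `v`, of order `μ`; by the mirrored duality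
`∫ h (left Caputo derivative of φ) = ⟨- D v, φ⟩ = ∫ v φ'`. -/
structure HasRightCaputoDeriv (μ : ℝ) (v h : ℝ → ℝ) : Prop where
  memLp : MemLp h 2 vol01
  weak : ∀ φ : ℝ → ℝ, IsTestFunction φ →
    ∫ x, h x * leftCaputo (1 - μ) φ x ∂vol01 = ∫ x, v x * deriv φ x ∂vol01

/-- The left Caputo space of order `μ ∈ (1/2, 1)`: functions in `L²(0,1)` whose left Caputo
derivative of order `μ` is in `L²(0,1)`. -/
def MemLeftCaputoSpace (μ : ℝ) (v : ℝ → ℝ) : Prop :=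
  MemLp v 2 vol01 ∧ ∃ g : ℝ → ℝ, HasLeftCaputoDeriv μ v g

/-- `vc` is the continuous representative on `[0,1]` of the (class of the) function `v`;
its values at `0` and `1` are the boundary values `v(0)` and `v(1)`. -/
structure IsContRep (v vc : ℝ → ℝ) : Prop where
  cont : ContinuousOn vc (Icc (0 : ℝ) 1)
  ae_eq : v =ᵐ[vol01] vc

/-- Weak solutions `u` of the conservative Caputo equation of order `2 - β` with the Caputo
Neumann boundary data `a₀`, `a₁`: `u` lies in the left Caputo space of order `1 - β/2`, and
`-(g, h) = (f, v) + a₁ v(1) - a₀ v(0)` for all `v` in that space, where `g` is the left Caputo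
derivative of `u` and `h` the right Caputo derivative of `v`, both of order `1 - β/2`.
For orders in `(1/2, 1)` every `v` in the left Caputo space has exactly one continuous
representative and, up to null sets, exactly one right Caputo derivative in `L²(0,1)`. -/
def IsWeakSolution (β : ℝ) (f : ℝ → ℝ) (a₀ a₁ : ℝ) (u : ℝ → ℝ) : Prop :=
  MemLp u 2 vol01 ∧
  ∃ g : ℝ → ℝ, HasLeftCaputoDeriv (1 - β / 2) u g ∧
    ∀ v vc h : ℝ → ℝ, MemLeftCaputoSpace (1 - β / 2) v → IsContRep v vc →
      HasRightCaputoDeriv (1 - β / 2) v h →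
      -∫ x, g x * h x ∂vol01 = (∫ x, f x * v x ∂vol01) + a₁ * vc 1 - a₀ * vc 0

/-- `w ∈ H¹(0,1)` with weak derivative `dw`. -/
structure HasH1Deriv (w dw : ℝ → ℝ) : Prop where
  memLp : MemLp w 2 vol01
  memLp_deriv : MemLp dw 2 vol01
  weak : ∀ φ : ℝ → ℝ, IsTestFunction φ →
    ∫ x, dw x * φ x ∂vol01 = -∫ x, w x * deriv φ x ∂vol01

/-- `w ∈ H¹(0,1)` is a weak solution of `-D² w = D f` on `(0,1)`, `w(0) = a₀`, `w(1) = a₁`: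
`∫ w' φ' = - ∫ f φ'` for all test functions `φ`. -/
def IsDirichletSolution (f : ℝ → ℝ) (a₀ a₁ : ℝ) (w : ℝ → ℝ) : Prop :=
  (∃ dw : ℝ → ℝ, HasH1Deriv w dw ∧ ∀ φ : ℝ → ℝ, IsTestFunction φ →
    ∫ x, dw x * deriv φ x ∂vol01 = -∫ x, f x * deriv φ x ∂vol01) ∧
  ∃ wc : ℝ → ℝ, IsContRep w wc ∧ wc 0 = a₀ ∧ wc 1 = a₁

end CaputoNeumann

end

/-!
Write `I^α` and `ᵣI^α` for the left and right fractional integrals on `(0, 1)`. They form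
semigroups in `α` (by the beta integral) and are adjoint to each other (by Fubini).

Given a test function `φ`, put `ψ = ᵣI^(1-β) φ'`, which is continuous. Testing the weak equation
with `v = I¹ ψ` is allowed, and the right Caputo derivative of `v` is
`-ᵣI^(β/2) ᵣI^(1-β) φ' = -ᵣI^(1-β/2) φ'`, the function against which the left Caputo derivative
of `u` is tested in its definition. So the left side of the equation becomes `∫ u φ'`, and, as
`v(0) = 0`, the right side is `∫ f I¹ψ + a₁ ∫ ψ = ∫ W ψ = ∫ (I^(1-β) W) φ'` for the Dirichlet
solution `W(x) = a₁ + ∫ₓ¹ f`. By the lemma of du Bois-Reymond `u - I^(1-β) W` is constant. The same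
lemma shows that a Dirichlet solution differs from `W` by an affine function, which the boundary
values force to vanish.
-/

namespace CaputoNeumann

theorem integral_sub_rpow_mul_sub_rpow {α β x z : ℝ} (hα : 0 < α) (hβ : 0 < β) (hzx : z < x) :
    ∫ y in z..x, (x - y) ^ (α - 1) * (y - z) ^ (β - 1) =
      (x - z) ^ (α + β - 1) * ProbabilityTheory.beta α β := by
  have hlen : 0 < x - z := sub_pos.2 hzx
  have hbeta := Complex.betaIntegral_scaled β α hlen
  rw [Complex.betaIntegral_symm, Complex.betaIntegral_eq_Gamma_mul_div _ _ (by simpa) (by simpa)]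
    at hbeta
  have hcast : ∫ t in (0 : ℝ)..(x - z),
        (t : ℂ) ^ ((β : ℂ) - 1) * (((x - z : ℝ) : ℂ) - t) ^ ((α : ℂ) - 1) =
      ((∫ t in (0 : ℝ)..(x - z), (x - z - t) ^ (α - 1) * t ^ (β - 1) : ℝ) : ℂ) := by
    rw [← intervalIntegral.integral_ofReal]
    refine intervalIntegral.integral_congr fun t ht => ?_
    rw [uIcc_of_le hlen.le] at ht
    push_cast [Complex.ofReal_cpow ht.1, Complex.ofReal_cpow (sub_nonneg.2 ht.2)]
    ring
  rw [hcast, show (β : ℂ) + α - 1 = ((α + β - 1 : ℝ) : ℂ) by push_cast; ring,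
    ← Complex.ofReal_cpow hlen.le, ← Complex.ofReal_add, Complex.Gamma_ofReal,
    Complex.Gamma_ofReal, Complex.Gamma_ofReal] at hbeta
  have hshift := intervalIntegral.integral_comp_sub_right (a := z) (b := x)
    (fun t => (x - z - t) ^ (α - 1) * t ^ (β - 1)) z
  simp only [sub_sub_sub_cancel_right, sub_self] at hshift
  rw [hshift, ProbabilityTheory.beta]
  exact_mod_cast hbeta

theorem integral_mul_integral_conv_swap {G : Type*} [AddGroup G] [MeasurableSpace G]
    [MeasurableAdd₂ G] [MeasurableNeg G] {μ ν : Measure G} [SFinite μ] [IsFiniteMeasure ν]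
    [μ.IsAddRightInvariant] {s : Set G} {k a b : G → ℝ} (hk : Integrable k μ)
    (ha : MemLp a ⊤ (μ.restrict s)) (hb : Integrable b ν) :
    ∫ x in s, a x * ∫ y, k (x - y) * b y ∂ν ∂μ =
      ∫ y, (∫ x in s, k (x - y) * a x ∂μ) * b y ∂ν := by
  have hkb : Integrable (fun p : G × G => b p.2 * k (p.1 - p.2)) ((μ.restrict s).prod ν) :=
    (hb.convolution_integrand (ContinuousLinearMap.mul ℝ ℝ) hk).mono_measure
      (Measure.prod_mono Measure.restrict_le_self le_rfl)
  have hint : Integrable (fun p : G × G => b p.2 * k (p.1 - p.2) * a p.1)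
      ((μ.restrict s).prod ν) := hkb.mul_of_top_left (ha.comp_fst ν)
  calc ∫ x in s, a x * ∫ y, k (x - y) * b y ∂ν ∂μ
      = ∫ x in s, ∫ y, b y * k (x - y) * a x ∂ν ∂μ := by
        simp only [← integral_const_mul, mul_comm]
    _ = ∫ y, ∫ x in s, b y * k (x - y) * a x ∂μ ∂ν := integral_integral_swap hint
    _ = ∫ y, (∫ x in s, k (x - y) * a x ∂μ) * b y ∂ν := by
        simp only [mul_comm (b _), mul_right_comm _ (b _), integral_mul_const]

theorem exists_Icc_between_of_isCompact {K s : Set ℝ} [s.OrdConnected] (hK : IsCompact K)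
    (hKs : K ⊆ s) : ∃ c d, K ⊆ Icc c d ∧ Icc c d ⊆ s := by
  rcases K.eq_empty_or_nonempty with rfl | hne
  · exact ⟨1, 0, empty_subset _, by simp⟩
  · exact ⟨sInf K, sSup K, subset_Icc_csInf_csSup hK.bddBelow hK.bddAbove,
      s.Icc_subset (hKs (hK.sInf_mem hne)) (hKs (hK.sSup_mem hne))⟩

section Primitive

variable {E : Type*} [NormedAddCommGroup E] [NormedSpace ℝ E] {χ : ℝ → E}

theorem support_integral_Iic_subset {c d : ℝ} (hsupp : Function.support χ ⊆ Icc c d)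
    (hzero : ∫ t, χ t = 0) : Function.support (fun x => ∫ t in Iic x, χ t) ⊆ Icc c d := by
  have hvanish : ∀ t ∉ Icc c d, χ t = 0 := fun t ht => Function.notMem_support.1 (mt (@hsupp t) ht)
  refine fun x hx => ⟨le_of_not_gt fun hxc => hx ?_, le_of_not_gt fun hdx => hx ?_⟩
  · exact setIntegral_eq_zero_of_forall_eq_zero fun t (ht : t ≤ x) =>
      hvanish t fun h => (ht.trans_lt hxc).not_ge h.1
  · refine (setIntegral_eq_integral_of_forall_compl_eq_zero fun t ht => ?_).trans hzero
    exact hvanish t fun h => ht (h.2.trans hdx.le)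

theorem hasDerivAt_integral_Iic [CompleteSpace E] (hχ : Continuous χ) (hint : Integrable χ)
    (x : ℝ) : HasDerivAt (fun x => ∫ t in Iic x, χ t) (χ x) x := by
  have hsplit : ∀ y, ∫ t in Iic y, χ t = (∫ t in Iic 0, χ t) + ∫ t in (0 : ℝ)..y, χ t := fun y => by
    rw [← intervalIntegral.integral_Iic_sub_Iic hint.integrableOn hint.integrableOn,
      add_sub_cancel]
  rw [funext hsplit]
  exact (hχ.integral_hasStrictDerivAt 0 x).hasDerivAt.const_add _

theorem exists_contDiff_tsupport_subset_deriv_eq [CompleteSpace E] {s : Set ℝ} [s.OrdConnected]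
    (hsmooth : ContDiff ℝ ∞ χ) (hcompact : HasCompactSupport χ) (hsupp : tsupport χ ⊆ s)
    (hzero : ∫ t, χ t = 0) :
    ∃ φ : ℝ → E, ContDiff ℝ ∞ φ ∧ HasCompactSupport φ ∧ tsupport φ ⊆ s ∧ deriv φ = χ := by
  obtain ⟨c, d, hχcd, hcds⟩ := exists_Icc_between_of_isCompact hcompact.isCompact hsupp
  have hderiv := hasDerivAt_integral_Iic hsmooth.continuous
    (hsmooth.continuous.integrable_of_hasCompactSupport hcompact)
  have hφcd : tsupport (fun x => ∫ t in Iic x, χ t) ⊆ Icc c d :=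
    closure_minimal (support_integral_Iic_subset ((subset_tsupport χ).trans hχcd) hzero)
      isClosed_Icc
  have hderiv_eq : deriv (fun x => ∫ t in Iic x, χ t) = χ := funext fun x => (hderiv x).deriv
  refine ⟨_, ?_, isCompact_Icc.of_isClosed_subset (isClosed_tsupport _) hφcd, hφcd.trans hcds,
    hderiv_eq⟩
  rw [contDiff_infty_iff_deriv, hderiv_eq]
  exact ⟨fun x => (hderiv x).differentiableAt, hsmooth⟩

end Primitive

theorem exists_contDiff_tsupport_subset_integral_eq_one {a b : ℝ} (hab : a < b) :
    ∃ η : ℝ → ℝ, ContDiff ℝ ∞ η ∧ HasCompactSupport η ∧ tsupport η ⊆ Ioo a b ∧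
      ∫ x, η x = 1 := by
  let B : ContDiffBump ((a + b) / 2) :=
    ⟨(b - a) / 8, (b - a) / 4, by linarith, by linarith⟩
  refine ⟨B.normed volume, B.contDiff_normed, B.hasCompactSupport_normed, ?_, B.integral_normed⟩
  rw [B.tsupport_normed_eq, Real.closedBall_eq_Icc]
  exact Icc_subset_Ioo (by change a < (a + b) / 2 - (b - a) / 4; linarith)
    (by change (a + b) / 2 + (b - a) / 4 < b; linarith)

theorem integrable_smul_of_tsupport_subset {E : Type*} [NormedAddCommGroup E] [NormedSpace ℝ E]
    {s : Set ℝ} {k : ℝ → E} (hk : LocallyIntegrableOn k s) {g : ℝ → ℝ} (hg : Continuous g)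
    (hcompact : HasCompactSupport g) (hsupp : tsupport g ⊆ s) :
    Integrable fun x => g x • k x := by
  rw [← integrableOn_iff_integrable_of_support_subset (s := tsupport g)]
  · exact (hk.integrableOn_compact_subset hsupp hcompact).continuousOn_smul hg.continuousOn
      hcompact.isCompact
  · exact (Function.support_smul_subset_left g k).trans (subset_tsupport g)

theorem exists_ae_eq_const_of_integral_deriv_smul_eq_zero {E : Type*} [NormedAddCommGroup E]
    [NormedSpace ℝ E] [CompleteSpace E] {a b : ℝ} (hab : a < b) {k : ℝ → E}
    (hk : LocallyIntegrableOn k (Ioo a b))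
    (h : ∀ φ : ℝ → ℝ, ContDiff ℝ ∞ φ → HasCompactSupport φ → tsupport φ ⊆ Ioo a b →
      ∫ x, deriv φ x • k x = 0) :
    ∃ c, ∀ᵐ x, x ∈ Ioo a b → k x = c := by
  obtain ⟨η, hη, hηc, hηs, hη1⟩ := exists_contDiff_tsupport_subset_integral_eq_one hab
  set c := ∫ x, η x • k x
  suffices hkc : ∀ᵐ x, x ∈ Ioo a b → k x - c = 0 from
    ⟨c, hkc.mono fun x hx hxs => sub_eq_zero.1 (hx hxs)⟩
  refine isOpen_Ioo.ae_eq_zero_of_integral_contDiff_smul_eq_zero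
    (hk.sub ((locallyIntegrable_const c).locallyIntegrableOn _)) fun g hg hgc hgs => ?_
  set m := ∫ x, g x
  have hgi : Integrable g := hg.continuous.integrable_of_hasCompactSupport hgc
  have hηi : Integrable η := hη.continuous.integrable_of_hasCompactSupport hηc
  have hgk := integrable_smul_of_tsupport_subset hk hg.continuous hgc hgs
  have hηk := integrable_smul_of_tsupport_subset hk hη.continuous hηc hηs
  -- Subtracting `m η` from `g` makes it the derivative of a test function.
  obtain ⟨φ, hφ, hφc, hφs, hφ'⟩ := exists_contDiff_tsupport_subset_deriv_eq
    (χ := fun x => g x - m * η x) (s := Ioo a b) (hg.sub (contDiff_const.mul hη))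
    (hgc.sub hηc.mul_left)
    ((tsupport_sub g fun x => m * η x).trans <| union_subset hgs <|
      (tsupport_mul_subset_right (f := fun _ => m)).trans hηs)
    (by rw [integral_sub hgi (hηi.const_mul m), integral_const_mul, hη1, mul_one, sub_self])
  calc ∫ x, g x • (k x - c) = (∫ x, g x • k x) - m • c := by
        simp only [smul_sub]
        rw [integral_sub hgk (hgi.smul_const c), integral_smul_const]
    _ = ∫ x, deriv φ x • k x := by
        simp only [hφ', sub_smul, mul_smul]
        rw [integral_sub hgk (hηk.fun_smul m), integral_smul]
    _ = 0 := h φ hφ hφc hφs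

instance : IsFiniteMeasure vol01 := inferInstanceAs (IsFiniteMeasure (volume.restrict _))

theorem ae_vol01_mem_Icc : ∀ᵐ x ∂vol01, x ∈ Icc (0 : ℝ) 1 :=
  (ae_restrict_mem measurableSet_Ioo).mono fun _ hx => Ioo_subset_Icc_self hx

theorem integral_vol01_congr {f g : ℝ → ℝ} (h : EqOn f g (Icc 0 1)) :
    ∫ x, f x ∂vol01 = ∫ x, g x ∂vol01 :=
  integral_congr_ae (ae_vol01_mem_Icc.mono h)

theorem integral_vol01 (f : ℝ → ℝ) : ∫ x, f x ∂vol01 = ∫ x in (0 : ℝ)..1, f x := by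
  rw [intervalIntegral.integral_of_le zero_le_one, integral_Ioc_eq_integral_Ioo, vol01]

theorem integral_vol01_comp_one_sub (f : ℝ → ℝ) : ∫ x, f (1 - x) ∂vol01 = ∫ x, f x ∂vol01 := by
  simp [integral_vol01]

theorem measurePreserving_one_sub_vol01 : MeasurePreserving (fun x : ℝ => 1 - x) vol01 vol01 := by
  simpa [vol01] using (volume.measurePreserving_sub_left (1 : ℝ)).restrict_preimage
    (measurableSet_Ioo (a := (0 : ℝ)) (b := 1))

theorem memLp_vol01_of_continuousOn {w : ℝ → ℝ} (hw : ContinuousOn w (Icc 0 1)) {p : ENNReal} :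
    MemLp w p vol01 := by
  obtain ⟨M, hM⟩ := isCompact_Icc.exists_bound_of_continuousOn hw
  exact MemLp.of_bound ((hw.mono Ioo_subset_Icc_self).aestronglyMeasurable measurableSet_Ioo) M
    (ae_vol01_mem_Icc.mono hM)

theorem integrable_vol01_of_continuousOn {w : ℝ → ℝ} (hw : ContinuousOn w (Icc 0 1)) :
    Integrable w vol01 :=
  memLp_one_iff_integrable.1 (memLp_vol01_of_continuousOn hw)

theorem integrable_mul_of_continuousOn {a b : ℝ → ℝ} (ha : Integrable a vol01)
    (hb : ContinuousOn b (Icc 0 1)) : Integrable (fun x => a x * b x) vol01 :=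
  ha.mul_of_top_left (memLp_vol01_of_continuousOn hb)

theorem one_sub_mem_Icc {x : ℝ} (hx : x ∈ Icc (0 : ℝ) 1) : 1 - x ∈ Icc (0 : ℝ) 1 :=
  ⟨sub_nonneg.2 hx.2, sub_le_self _ hx.1⟩

theorem continuousOn_comp_one_sub {w : ℝ → ℝ} (hw : ContinuousOn w (Icc 0 1)) :
    ContinuousOn (fun x => w (1 - x)) (Icc 0 1) :=
  hw.comp (by fun_prop) fun _ => one_sub_mem_Icc

theorem rightFracInt_eq_leftFracInt_one_sub (α : ℝ) (w : ℝ → ℝ) (x : ℝ) :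
    rightFracInt α w x = leftFracInt α (fun t => w (1 - t)) (1 - x) := by
  have hreflect := intervalIntegral.integral_comp_sub_left (a := 0) (b := 1 - x)
    (fun s => w s / (s - x) ^ (1 - α)) 1
  simp only [sub_sub_cancel, sub_zero, sub_right_comm 1 _ x] at hreflect
  rw [rightFracInt, leftFracInt, hreflect]

/-- The kernel `t₊ ^ (α - 1) / Γ(α)` of the fractional integrals of order `α`. It is cut off at
`1`, which no difference of two points of `[0, 1]` exceeds, to be integrable on the line. -/
noncomputable def fracKernel (α : ℝ) : ℝ → ℝ :=
  (Ioc 0 1).indicator fun t => t ^ (α - 1) / Real.Gamma α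

theorem fracKernel_of_nonpos (α : ℝ) {t : ℝ} (ht : t ≤ 0) : fracKernel α t = 0 :=
  indicator_of_notMem (fun h => ht.not_gt h.1) _

theorem fracKernel_of_mem (α : ℝ) {t : ℝ} (ht : t ∈ Ioc (0 : ℝ) 1) :
    fracKernel α t = t ^ (α - 1) / Real.Gamma α :=
  indicator_of_mem ht _

theorem integrable_fracKernel {α : ℝ} (hα : 0 < α) : Integrable (fracKernel α) := by
  rw [fracKernel, integrable_indicator_iff measurableSet_Ioc,
    ← intervalIntegrable_iff_integrableOn_Ioc_of_le zero_le_one]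
  exact (intervalIntegral.intervalIntegrable_rpow' (by linarith)).div_const _

theorem integrable_fracKernel_sub_left {α : ℝ} (hα : 0 < α) (x : ℝ) :
    Integrable (fun y => fracKernel α (x - y)) vol01 :=
  ((integrable_fracKernel hα).comp_sub_left x).restrict

theorem leftFracInt_eq_integral_fracKernel (α : ℝ) (w : ℝ → ℝ) {x : ℝ} (hx : x ∈ Icc (0 : ℝ) 1) :
    leftFracInt α w x = ∫ y, fracKernel α (x - y) * w y ∂vol01 := by
  have hleft : ∀ y ∈ Ioo 0 x,
      1 / Real.Gamma α * (w y / (x - y) ^ (1 - α)) = fracKernel α (x - y) * w y := fun y hy => by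
    have hxy : x - y ∈ Ioc 0 1 := ⟨sub_pos.2 hy.2, by linarith [hx.2, hy.1]⟩
    rw [fracKernel_of_mem α hxy, ← neg_sub 1 α, Real.rpow_neg hxy.1.le]
    ring
  calc leftFracInt α w x = ∫ y in Ioo 0 x, fracKernel α (x - y) * w y := by
        rw [leftFracInt, intervalIntegral.integral_of_le hx.1, integral_Ioc_eq_integral_Ioo,
          ← integral_const_mul]
        exact setIntegral_congr_fun measurableSet_Ioo hleft
    _ = ∫ y, fracKernel α (x - y) * w y ∂vol01 := by
        refine (setIntegral_eq_of_subset_of_forall_sdiff_eq_zero measurableSet_Ioo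
          (Ioo_subset_Ioo_right hx.2) fun y hy => ?_).symm
        rw [fracKernel_of_nonpos α (sub_nonpos.2 (not_lt.1 fun h => hy.2 ⟨hy.1.1, h⟩)), zero_mul]

theorem rightFracInt_eq_integral_fracKernel (α : ℝ) (w : ℝ → ℝ) {x : ℝ} (hx : x ∈ Icc (0 : ℝ) 1) :
    rightFracInt α w x = ∫ y, fracKernel α (y - x) * w y ∂vol01 := by
  rw [rightFracInt_eq_leftFracInt_one_sub,
    leftFracInt_eq_integral_fracKernel α _ (one_sub_mem_Icc hx), ← integral_vol01_comp_one_sub]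
  simp only [sub_sub_sub_cancel_left, sub_sub_cancel]

theorem rightFracInt_congr_ae (α : ℝ) {w w' : ℝ → ℝ} (h : w =ᵐ[vol01] w') {x : ℝ}
    (hx : x ∈ Icc (0 : ℝ) 1) : rightFracInt α w x = rightFracInt α w' x := by
  rw [rightFracInt_eq_integral_fracKernel α w hx, rightFracInt_eq_integral_fracKernel α w' hx]
  exact integral_congr_ae (h.mono fun y hy => by simp only [hy])

theorem integral_rightFracInt_mul {α : ℝ} (hα : 0 < α) {a b : ℝ → ℝ} (ha : MemLp a ⊤ vol01)
    (hb : Integrable b vol01) :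
    ∫ x, rightFracInt α a x * b x ∂vol01 = ∫ x, a x * leftFracInt α b x ∂vol01 :=
  calc ∫ x, rightFracInt α a x * b x ∂vol01
      = ∫ y, (∫ x, fracKernel α (x - y) * a x ∂vol01) * b y ∂vol01 :=
        integral_vol01_congr fun x hx => by
          simp only [rightFracInt_eq_integral_fracKernel α a hx]
    _ = ∫ x, a x * ∫ y, fracKernel α (x - y) * b y ∂vol01 ∂vol01 :=
        (integral_mul_integral_conv_swap (integrable_fracKernel hα) ha hb).symm
    _ = ∫ x, a x * leftFracInt α b x ∂vol01 :=
        integral_vol01_congr fun x hx => by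
          simp only [leftFracInt_eq_integral_fracKernel α b hx]

theorem integral_leftFracInt_mul {α : ℝ} (hα : 0 < α) {a b : ℝ → ℝ} (ha : MemLp a ⊤ vol01)
    (hb : Integrable b vol01) :
    ∫ x, leftFracInt α a x * b x ∂vol01 = ∫ x, a x * rightFracInt α b x ∂vol01 := by
  have hreflect := integral_rightFracInt_mul hα
    (ha.comp_measurePreserving measurePreserving_one_sub_vol01)
    (measurePreserving_one_sub_vol01.integrable_comp_of_integrable hb)
  rw [← integral_vol01_comp_one_sub, ← integral_vol01_comp_one_sub fun x => a x * _]
  simpa [rightFracInt_eq_leftFracInt_one_sub, Function.comp_def] using hreflect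

theorem integral_fracKernel_mul_fracKernel {α β : ℝ} (hα : 0 < α) (hβ : 0 < β) {x z : ℝ}
    (hx : x ∈ Icc (0 : ℝ) 1) (hz : z ∈ Icc (0 : ℝ) 1) :
    ∫ y, fracKernel α (x - y) * fracKernel β (y - z) ∂vol01 = fracKernel (α + β) (x - z) := by
  have hvanish : ∀ y ∉ Ioo z x, fracKernel α (x - y) * fracKernel β (y - z) = 0 := fun y hy => by
    rcases le_or_gt y z with hyz | hzy
    · rw [fracKernel_of_nonpos β (sub_nonpos.2 hyz), mul_zero]
    · rw [fracKernel_of_nonpos α (sub_nonpos.2 (not_lt.1 fun h => hy ⟨hzy, h⟩)), zero_mul]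
  rcases le_or_gt x z with hxz | hzx
  · rw [fracKernel_of_nonpos _ (sub_nonpos.2 hxz)]
    exact integral_eq_zero_of_ae (ae_of_all _ fun y => hvanish y (by simp [hxz]))
  have hinside : ∀ y ∈ Ioo z x, fracKernel α (x - y) * fracKernel β (y - z) =
      (x - y) ^ (α - 1) * (y - z) ^ (β - 1) / (Real.Gamma α * Real.Gamma β) := fun y hy => by
    rw [fracKernel_of_mem α ⟨sub_pos.2 hy.2, by linarith [hx.2, hz.1, hy.1]⟩,
      fracKernel_of_mem β ⟨sub_pos.2 hy.1, by linarith [hx.2, hz.1, hy.2]⟩, div_mul_div_comm]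
  calc ∫ y, fracKernel α (x - y) * fracKernel β (y - z) ∂vol01
      = ∫ y in Ioo z x, fracKernel α (x - y) * fracKernel β (y - z) :=
        setIntegral_eq_of_subset_of_forall_sdiff_eq_zero measurableSet_Ioo
          (Ioo_subset_Ioo hz.1 hx.2) fun y hy => hvanish y hy.2
    _ = (∫ y in z..x, (x - y) ^ (α - 1) * (y - z) ^ (β - 1)) /
          (Real.Gamma α * Real.Gamma β) := by
        rw [setIntegral_congr_fun measurableSet_Ioo hinside, integral_div,
          intervalIntegral.integral_of_le hzx.le, integral_Ioc_eq_integral_Ioo]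
    _ = fracKernel (α + β) (x - z) := by
        rw [integral_sub_rpow_mul_sub_rpow hα hβ hzx, ProbabilityTheory.beta,
          fracKernel_of_mem _ ⟨sub_pos.2 hzx, by linarith [hx.2, hz.1]⟩]
        field_simp [(Real.Gamma_pos_of_pos hα).ne', (Real.Gamma_pos_of_pos hβ).ne']

theorem leftFracInt_leftFracInt {α β : ℝ} (hα : 0 < α) (hβ : 0 < β) {w : ℝ → ℝ}
    (hw : MemLp w ⊤ vol01) {x : ℝ} (hx : x ∈ Icc (0 : ℝ) 1) :
    leftFracInt α (leftFracInt β w) x = leftFracInt (α + β) w x :=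
  calc leftFracInt α (leftFracInt β w) x
      = ∫ y, leftFracInt β w y * fracKernel α (x - y) ∂vol01 := by
        simp only [leftFracInt_eq_integral_fracKernel α _ hx, mul_comm]
    _ = ∫ z, w z * rightFracInt β (fun y => fracKernel α (x - y)) z ∂vol01 :=
        integral_leftFracInt_mul hβ hw (integrable_fracKernel_sub_left hα x)
    _ = ∫ z, fracKernel (α + β) (x - z) * w z ∂vol01 :=
        integral_vol01_congr fun z hz => by
          simp only [rightFracInt_eq_integral_fracKernel β _ hz, mul_comm (fracKernel β _),
            integral_fracKernel_mul_fracKernel hα hβ hx hz, mul_comm]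
    _ = leftFracInt (α + β) w x := (leftFracInt_eq_integral_fracKernel _ _ hx).symm

theorem rightFracInt_rightFracInt {α β : ℝ} (hα : 0 < α) (hβ : 0 < β) {w : ℝ → ℝ}
    (hw : MemLp w ⊤ vol01) {x : ℝ} (hx : x ∈ Icc (0 : ℝ) 1) :
    rightFracInt α (rightFracInt β w) x = rightFracInt (α + β) w x := by
  simpa [rightFracInt_eq_leftFracInt_one_sub, Function.comp_def] using leftFracInt_leftFracInt hα hβ
    (hw.comp_measurePreserving measurePreserving_one_sub_vol01) (one_sub_mem_Icc hx)

theorem leftFracInt_one (w : ℝ → ℝ) (x : ℝ) : leftFracInt 1 w x = ∫ s in (0 : ℝ)..x, w s := by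
  simp [leftFracInt]

theorem rightFracInt_one (w : ℝ → ℝ) (x : ℝ) : rightFracInt 1 w x = ∫ s in x..(1 : ℝ), w s := by
  simp [rightFracInt]

theorem rightFracInt_neg (α : ℝ) (w : ℝ → ℝ) (x : ℝ) :
    rightFracInt α (fun s => -w s) x = -rightFracInt α w x := by
  simp [rightFracInt, neg_div]

theorem leftFracInt_eq_rpow_mul_leftFracInt_scaled {α : ℝ} (hα : 0 < α) (w : ℝ → ℝ) {x : ℝ}
    (hx : 0 ≤ x) : leftFracInt α w x = x ^ α * leftFracInt α (fun t => w (x * t)) 1 := by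
  rcases hx.eq_or_lt with rfl | hx
  · simp [leftFracInt, Real.zero_rpow hα.ne']
  have hscale := intervalIntegral.smul_integral_comp_mul_left (a := 0) (b := 1)
    (fun s => w s / (x - s) ^ (1 - α)) x
  rw [mul_zero, mul_one, smul_eq_mul] at hscale
  rw [leftFracInt, leftFracInt, ← hscale, mul_left_comm (x ^ α)]
  congr 1
  rw [← intervalIntegral.integral_const_mul, ← intervalIntegral.integral_const_mul]
  refine intervalIntegral.integral_congr fun t ht => ?_
  rw [uIcc_of_le zero_le_one] at ht
  have hpow : x ^ α = x / x ^ (1 - α) := by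
    rw [Real.rpow_sub hx, Real.rpow_one, div_div_cancel₀ hx.ne']
  simp only [← mul_one_sub, Real.mul_rpow hx.le (sub_nonneg.2 ht.2), hpow]
  ring

theorem continuousOn_leftFracInt {α : ℝ} (hα : 0 < α) {w : ℝ → ℝ}
    (hw : ContinuousOn w (Icc 0 1)) : ContinuousOn (leftFracInt α w) (Icc 0 1) := by
  have hmem : ∀ {x t : ℝ}, x ∈ Icc (0 : ℝ) 1 → t ∈ Icc (0 : ℝ) 1 → x * t ∈ Icc (0 : ℝ) 1 :=
    fun hx ht => ⟨mul_nonneg hx.1 ht.1, mul_le_one₀ hx.2 ht.1 ht.2⟩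
  obtain ⟨M, hM⟩ := isCompact_Icc.exists_bound_of_continuousOn hw
  have hk := integrable_fracKernel_sub_left hα 1
  -- Scaling `s = x t` moves `x` out of the singular kernel, so that convergence is dominated.
  have hscaled : ContinuousOn (fun x => ∫ t, fracKernel α (1 - t) * w (x * t) ∂vol01)
      (Icc 0 1) := by
    refine MeasureTheory.continuousOn_of_dominated
      (bound := fun t => ‖fracKernel α (1 - t)‖ * M) (fun x hx => ?_) (fun x hx => ?_)
      (hk.norm.mul_const M) ?_
    · exact (integrable_mul_of_continuousOn hk (b := fun t => w (x * t))
        (hw.comp (by fun_prop) fun t ht => hmem hx ht)).aestronglyMeasurable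
    · filter_upwards [ae_vol01_mem_Icc] with t ht
      rw [norm_mul]
      gcongr
      exact hM _ (hmem hx ht)
    · filter_upwards [ae_vol01_mem_Icc] with t ht
      exact continuousOn_const.mul (hw.comp (by fun_prop) fun x hx => hmem hx ht)
  refine ((Real.continuous_rpow_const hα.le).continuousOn.mul hscaled).congr fun x hx => ?_
  rw [Pi.mul_apply, leftFracInt_eq_rpow_mul_leftFracInt_scaled hα w hx.1,
    leftFracInt_eq_integral_fracKernel α _ (right_mem_Icc.2 zero_le_one)]

theorem continuousOn_rightFracInt {α : ℝ} (hα : 0 < α) {w : ℝ → ℝ}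
    (hw : ContinuousOn w (Icc 0 1)) : ContinuousOn (rightFracInt α w) (Icc 0 1) :=
  (continuousOn_comp_one_sub (continuousOn_leftFracInt hα (continuousOn_comp_one_sub hw))).congr
    fun x _ => rightFracInt_eq_leftFracInt_one_sub α w x

section TestFunctions

variable {φ : ℝ → ℝ}

theorem IsTestFunction.continuous_deriv (hφ : IsTestFunction φ) : Continuous (deriv φ) :=
  hφ.smooth.continuous_deriv (by simp)

theorem IsTestFunction.eq_zero_of_notMem (hφ : IsTestFunction φ) {x : ℝ}
    (hx : x ∉ Ioo (0 : ℝ) 1) : φ x = 0 :=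
  image_eq_zero_of_notMem_tsupport fun hx' => hx (hφ.support hx')

theorem IsTestFunction.integral_deriv (hφ : IsTestFunction φ) (a b : ℝ) :
    ∫ x in a..b, deriv φ x = φ b - φ a :=
  intervalIntegral.integral_deriv_eq_sub
    (fun x _ => (hφ.smooth.differentiable (by simp)).differentiableAt)
    (hφ.continuous_deriv.intervalIntegrable _ _)

theorem IsTestFunction.leftFracInt_one_deriv (hφ : IsTestFunction φ) :
    leftFracInt 1 (deriv φ) = φ := by
  ext x
  rw [leftFracInt_one, hφ.integral_deriv, hφ.eq_zero_of_notMem (x := 0) (by simp), sub_zero]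

theorem IsTestFunction.rightFracInt_one_deriv (hφ : IsTestFunction φ) (x : ℝ) :
    rightFracInt 1 (deriv φ) x = -φ x := by
  rw [rightFracInt_one, hφ.integral_deriv, hφ.eq_zero_of_notMem (x := 1) (by simp), zero_sub]

theorem IsTestFunction.integral_deriv_vol01 (hφ : IsTestFunction φ) :
    ∫ x, deriv φ x ∂vol01 = 0 := by
  rw [integral_vol01, hφ.integral_deriv, hφ.eq_zero_of_notMem (by simp),
    hφ.eq_zero_of_notMem (by simp), sub_zero]

theorem exists_ae_eq_add_const_of_integral_mul_deriv_eq {k l : ℝ → ℝ} (hk : Integrable k vol01)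
    (hl : Integrable l vol01)
    (h : ∀ φ, IsTestFunction φ → ∫ x, k x * deriv φ x ∂vol01 = ∫ x, l x * deriv φ x ∂vol01) :
    ∃ c, k =ᵐ[vol01] fun x => l x + c := by
  have hkl : LocallyIntegrableOn (k - l) (Ioo 0 1) :=
    IntegrableOn.locallyIntegrableOn (hk.sub hl)
  obtain ⟨c, hc⟩ := exists_ae_eq_const_of_integral_deriv_smul_eq_zero zero_lt_one hkl
    fun φ hsmooth hcompact hsupp => by
      have hφ : IsTestFunction φ := ⟨hsmooth, hcompact, hsupp⟩
      have hcont := hφ.continuous_deriv.continuousOn (s := Icc 0 1)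
      calc ∫ x, deriv φ x • (k - l) x = ∫ x, k x * deriv φ x - l x * deriv φ x ∂vol01 := by
            simp only [Pi.sub_apply, smul_eq_mul, ← sub_mul, mul_comm (deriv φ _)]
            refine (setIntegral_eq_integral_of_forall_compl_eq_zero fun x hx => ?_).symm
            rw [image_eq_zero_of_notMem_tsupport fun hx' =>
              hx (hsupp (tsupport_deriv_subset hx')), mul_zero]
        _ = 0 := by
            rw [integral_sub (integrable_mul_of_continuousOn hk hcont)
              (integrable_mul_of_continuousOn hl hcont), h φ hφ, sub_self]
  refine ⟨c, (ae_restrict_iff' measurableSet_Ioo).2 (hc.mono fun x hx hxs => ?_)⟩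
  simp only [← hx hxs, Pi.sub_apply, add_sub_cancel]

end TestFunctions

section Primitives

variable {ψ : ℝ → ℝ} {μ : ℝ}

theorem intervalIntegrable_of_integrable_vol01 {f : ℝ → ℝ} (hf : Integrable f vol01) {x : ℝ}
    (hx : x ∈ Icc (0 : ℝ) 1) : IntervalIntegrable f volume x 1 :=
  (intervalIntegrable_iff_integrableOn_Ioo_of_le hx.2).2
    (IntegrableOn.mono_set hf (Ioo_subset_Ioo_left hx.1))

theorem continuousOn_rightFracInt_one {f : ℝ → ℝ} (hf : Integrable f vol01) :
    ContinuousOn (rightFracInt 1 f) (Icc 0 1) := by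
  rw [funext (rightFracInt_one f), ← uIcc_of_le zero_le_one]
  refine intervalIntegral.continuousOn_primitive_interval_left ?_
  rwa [uIcc_of_le zero_le_one, integrableOn_Icc_iff_integrableOn_Ioo]

theorem hasLeftCaputoDeriv_leftFracInt_one (hμ0 : 0 < μ) (hμ1 : μ < 1)
    (hψ : ContinuousOn ψ (Icc 0 1)) :
    HasLeftCaputoDeriv μ (leftFracInt 1 ψ) (leftFracInt (1 - μ) ψ) := by
  have hν : 0 < 1 - μ := sub_pos.2 hμ1
  refine ⟨memLp_vol01_of_continuousOn (continuousOn_leftFracInt hν hψ), fun φ hφ => ?_⟩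
  have hψb : MemLp ψ ⊤ vol01 := memLp_vol01_of_continuousOn hψ
  have hdφ : ContinuousOn (fun s => -deriv φ s) (Icc 0 1) := hφ.continuous_deriv.neg.continuousOn
  calc ∫ x, leftFracInt (1 - μ) ψ x * rightCaputo (1 - μ) φ x ∂vol01
      = ∫ x, ψ x * rightFracInt (1 - μ) (rightFracInt μ fun s => -deriv φ s) x ∂vol01 := by
        rw [rightCaputo, sub_sub_cancel, integral_leftFracInt_mul hν hψb
          (integrable_vol01_of_continuousOn (continuousOn_rightFracInt hμ0 hdφ))]
    _ = ∫ x, ψ x * rightFracInt 1 (fun s => -deriv φ s) x ∂vol01 :=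
        integral_vol01_congr fun x hx => by
          simp only [rightFracInt_rightFracInt hν hμ0 (memLp_vol01_of_continuousOn hdφ) hx,
            sub_add_cancel]
    _ = -∫ x, leftFracInt 1 ψ x * deriv φ x ∂vol01 := by
        rw [← integral_leftFracInt_mul one_pos hψb (integrable_vol01_of_continuousOn hdφ),
          ← integral_neg]
        simp only [mul_neg]

theorem hasRightCaputoDeriv_leftFracInt_one (hμ0 : 0 < μ) (hμ1 : μ < 1)
    (hψ : ContinuousOn ψ (Icc 0 1)) :
    HasRightCaputoDeriv μ (leftFracInt 1 ψ) (rightFracInt (1 - μ) fun s => -ψ s) := by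
  have hν : 0 < 1 - μ := sub_pos.2 hμ1
  refine ⟨memLp_vol01_of_continuousOn (continuousOn_rightFracInt hν hψ.neg), fun φ hφ => ?_⟩
  have hdφ : ContinuousOn (deriv φ) (Icc 0 1) := hφ.continuous_deriv.continuousOn
  calc ∫ x, rightFracInt (1 - μ) (fun s => -ψ s) x * leftCaputo (1 - μ) φ x ∂vol01
      = ∫ x, -ψ x * leftFracInt (1 - μ) (leftFracInt μ (deriv φ)) x ∂vol01 := by
        rw [leftCaputo, sub_sub_cancel, integral_rightFracInt_mul hν
          (memLp_vol01_of_continuousOn hψ.fun_neg)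
          (integrable_vol01_of_continuousOn (continuousOn_leftFracInt hμ0 hdφ))]
    _ = ∫ x, ψ x * rightFracInt 1 (deriv φ) x ∂vol01 :=
        integral_vol01_congr fun x hx => by
          simp only [leftFracInt_leftFracInt hν hμ0 (memLp_vol01_of_continuousOn hdφ) hx,
            sub_add_cancel, hφ.leftFracInt_one_deriv, hφ.rightFracInt_one_deriv, neg_mul, mul_neg]
    _ = ∫ x, leftFracInt 1 ψ x * deriv φ x ∂vol01 :=
        (integral_leftFracInt_mul one_pos (memLp_vol01_of_continuousOn hψ)
          (integrable_vol01_of_continuousOn hdφ)).symm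

end Primitives

theorem IsContRep.eqOn_Icc {v vc v' vc' : ℝ → ℝ} (h : IsContRep v vc) (h' : IsContRep v' vc')
    (hv : v =ᵐ[vol01] v') : EqOn vc vc' (Icc 0 1) := by
  refine Measure.eqOn_Icc_of_ae_eq volume zero_ne_one ?_ h.cont h'.cont
  rw [← restrict_Ioo_eq_restrict_Icc]
  exact h.ae_eq.symm.trans (hv.trans h'.ae_eq)

theorem IsContRep.of_continuousOn {v : ℝ → ℝ} (hv : ContinuousOn v (Icc 0 1)) : IsContRep v v :=
  ⟨hv, Filter.EventuallyEq.rfl⟩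

theorem HasH1Deriv.sub_eq_rightFracInt_one {w dw wc : ℝ → ℝ} (hw : HasH1Deriv w dw)
    (hwc : IsContRep w wc) {x : ℝ} (hx : x ∈ Icc (0 : ℝ) 1) :
    wc 1 - wc x = rightFracInt 1 dw x := by
  have hdw : Integrable dw vol01 := hw.memLp_deriv.integrable one_le_two
  have hcont := continuousOn_rightFracInt_one hdw
  obtain ⟨c, hc⟩ := exists_ae_eq_add_const_of_integral_mul_deriv_eq
    (hw.memLp.integrable one_le_two) (integrable_vol01_of_continuousOn hcont.neg) fun φ hφ => by
      have hdφ : ContinuousOn (deriv φ) (Icc 0 1) := hφ.continuous_deriv.continuousOn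
      have hswap := integral_leftFracInt_mul one_pos (memLp_vol01_of_continuousOn hdφ) hdw
      rw [hφ.leftFracInt_one_deriv] at hswap
      rw [eq_neg_of_add_eq_zero_left (neg_eq_iff_add_eq_zero.1 (hw.weak φ hφ).symm)]
      simp only [Pi.neg_apply, neg_mul, integral_neg, mul_comm (dw _), hswap,
        mul_comm (rightFracInt _ _ _)]
  have heq := hwc.eqOn_Icc (.of_continuousOn (hcont.neg.add (continuousOn_const (c := c)))) hc
  have h1 : rightFracInt 1 dw 1 = 0 := by simp [rightFracInt]
  rw [heq hx, heq (right_mem_Icc.2 zero_le_one)]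
  simp [h1]

section Dirichlet

variable {f : ℝ → ℝ} {a₀ a₁ : ℝ}

/-- The solution `x ↦ a₁ + ∫ₓ¹ f` of the Dirichlet problem `-D² w = D f`, `w(1) = a₁`. Its value
at `0` is not a parameter but the `a₀` of the solvability condition `∫ f + a₁ - a₀ = 0`. -/
noncomputable def dirichletSolution (f : ℝ → ℝ) (a₁ x : ℝ) : ℝ := a₁ + rightFracInt 1 f x

theorem continuousOn_dirichletSolution (hf : Integrable f vol01) (a₁ : ℝ) :
    ContinuousOn (dirichletSolution f a₁) (Icc 0 1) :=
  continuousOn_const.add (continuousOn_rightFracInt_one hf)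

theorem dirichletSolution_one (f : ℝ → ℝ) (a₁ : ℝ) : dirichletSolution f a₁ 1 = a₁ := by
  simp [dirichletSolution, rightFracInt_one]

theorem dirichletSolution_zero (f : ℝ → ℝ) (a₁ : ℝ) :
    dirichletSolution f a₁ 0 = a₁ + ∫ x, f x ∂vol01 := by
  rw [dirichletSolution, rightFracInt_one, integral_vol01]

theorem integral_dirichletSolution_mul (hf : Integrable f vol01) (a₁ : ℝ) {ψ : ℝ → ℝ}
    (hψ : ContinuousOn ψ (Icc 0 1)) :
    ∫ x, dirichletSolution f a₁ x * ψ x ∂vol01 =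
      a₁ * ∫ x, ψ x ∂vol01 + ∫ x, f x * leftFracInt 1 ψ x ∂vol01 := by
  have hswap := integral_leftFracInt_mul one_pos (memLp_vol01_of_continuousOn hψ) hf
  have hrf := integrable_vol01_of_continuousOn (continuousOn_rightFracInt_one hf)
  simp only [dirichletSolution, add_mul]
  rw [integral_add ((integrable_vol01_of_continuousOn hψ).const_mul a₁)
    (integrable_mul_of_continuousOn hrf hψ), integral_const_mul]
  simp only [mul_comm (rightFracInt _ _ _), mul_comm (f _), hswap]

theorem hasH1Deriv_dirichletSolution (hf : MemLp f 2 vol01) (a₁ : ℝ) :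
    HasH1Deriv (dirichletSolution f a₁) (fun x => -f x) := by
  have hfi : Integrable f vol01 := hf.integrable one_le_two
  refine ⟨memLp_vol01_of_continuousOn (continuousOn_dirichletSolution hfi a₁), hf.neg,
    fun φ hφ => ?_⟩
  rw [integral_dirichletSolution_mul hfi a₁ hφ.continuous_deriv.continuousOn,
    hφ.integral_deriv_vol01, hφ.leftFracInt_one_deriv, mul_zero, zero_add, ← integral_neg]
  simp only [neg_mul]

theorem isDirichletSolution_dirichletSolution (hf : MemLp f 2 vol01)
    (h : (∫ x, f x ∂vol01) + a₁ - a₀ = 0) :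
    IsDirichletSolution f a₀ a₁ (dirichletSolution f a₁) := by
  refine ⟨⟨_, hasH1Deriv_dirichletSolution hf a₁, fun φ _ => ?_⟩, _,
    .of_continuousOn (continuousOn_dirichletSolution (hf.integrable one_le_two) a₁), ?_,
    dirichletSolution_one f a₁⟩
  · simp only [neg_mul, integral_neg]
  · rw [dirichletSolution_zero]
    linarith

theorem IsDirichletSolution.ae_eq_dirichletSolution (hf : Integrable f vol01)
    (h : (∫ x, f x ∂vol01) + a₁ - a₀ = 0) {w : ℝ → ℝ} (hw : IsDirichletSolution f a₀ a₁ w) :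
    w =ᵐ[vol01] dirichletSolution f a₁ := by
  obtain ⟨⟨dw, hdw, hweak⟩, wc, hwc, hw0, hw1⟩ := hw
  obtain ⟨C, hC⟩ := exists_ae_eq_add_const_of_integral_mul_deriv_eq
    (hdw.memLp_deriv.integrable one_le_two) hf.neg fun φ hφ => by
      simp only [hweak φ hφ, Pi.neg_apply, neg_mul, integral_neg]
  have hformula : ∀ x ∈ Icc (0 : ℝ) 1, wc x = dirichletSolution f a₁ x - C * (1 - x) :=
    fun x hx => by
      have hftc := hdw.sub_eq_rightFracInt_one hwc hx
      have hfx : IntervalIntegrable (fun t => -f t) volume x 1 :=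
        intervalIntegrable_of_integrable_vol01 hf.neg hx
      rw [rightFracInt_congr_ae 1 hC hx, rightFracInt_one] at hftc
      simp only [Pi.neg_apply] at hftc
      rw [intervalIntegral.integral_add hfx intervalIntegrable_const,
        intervalIntegral.integral_neg, intervalIntegral.integral_const, hw1, smul_eq_mul] at hftc
      rw [dirichletSolution, rightFracInt_one]
      linarith
  have hC0 : C = 0 := by
    have h0 := hformula 0 (left_mem_Icc.2 zero_le_one)
    rw [hw0, dirichletSolution_zero] at h0
    linarith
  filter_upwards [hwc.ae_eq, ae_vol01_mem_Icc] with x hx hxs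
  rw [hx, hformula x hxs, hC0, zero_mul, sub_zero]

end Dirichlet

namespace IsWeakSolution

variable {β : ℝ} {f u : ℝ → ℝ} {a₀ a₁ : ℝ}

theorem integral_mul_deriv (hu : IsWeakSolution β f a₀ a₁ u) (hβ0 : 0 < β) (hβ1 : β < 1)
    (hf : Integrable f vol01) {φ : ℝ → ℝ} (hφ : IsTestFunction φ) :
    ∫ x, u x * deriv φ x ∂vol01 =
      ∫ x, leftFracInt (1 - β) (dirichletSolution f a₁) x * deriv φ x ∂vol01 := by
  obtain ⟨-, g, hg, hweak⟩ := hu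
  have hdφ : ContinuousOn (deriv φ) (Icc 0 1) := hφ.continuous_deriv.continuousOn
  have hν : 0 < 1 - β := sub_pos.2 hβ1
  have hμ0 : 0 < 1 - β / 2 := by linarith
  have hμ1 : 1 - β / 2 < 1 := by linarith
  let ψ := rightFracInt (1 - β) (deriv φ)
  have hψ : ContinuousOn ψ (Icc 0 1) := continuousOn_rightFracInt hν hdφ
  have hv : ContinuousOn (leftFracInt 1 ψ) (Icc 0 1) := continuousOn_leftFracInt one_pos hψ
  have hsemigroup : ∀ x ∈ Icc (0 : ℝ) 1, rightCaputo (1 - (1 - β / 2)) φ x =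
      rightFracInt (1 - (1 - β / 2)) (fun s => -ψ s) x := fun x hx => by
    rw [rightCaputo, rightFracInt_neg, rightFracInt_neg, rightFracInt_rightFracInt (by linarith)
      hν (memLp_vol01_of_continuousOn hdφ) hx]
    ring_nf
  calc ∫ x, u x * deriv φ x ∂vol01
      = -∫ x, g x * rightCaputo (1 - (1 - β / 2)) φ x ∂vol01 := by rw [hg.weak φ hφ, neg_neg]
    _ = -∫ x, g x * rightFracInt (1 - (1 - β / 2)) (fun s => -ψ s) x ∂vol01 :=
        congrArg _ (integral_vol01_congr fun x hx => by simp only [hsemigroup x hx])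
    _ = (∫ x, f x * leftFracInt 1 ψ x ∂vol01) + a₁ * leftFracInt 1 ψ 1 -
          a₀ * leftFracInt 1 ψ 0 :=
        hweak _ _ _ ⟨memLp_vol01_of_continuousOn hv, _,
            hasLeftCaputoDeriv_leftFracInt_one hμ0 hμ1 hψ⟩
          (.of_continuousOn hv) (hasRightCaputoDeriv_leftFracInt_one hμ0 hμ1 hψ)
    _ = ∫ x, dirichletSolution f a₁ x * ψ x ∂vol01 := by
        rw [integral_dirichletSolution_mul hf a₁ hψ, leftFracInt_one ψ 0, leftFracInt_one ψ 1,
          intervalIntegral.integral_same, integral_vol01 ψ]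
        ring
    _ = ∫ x, leftFracInt (1 - β) (dirichletSolution f a₁) x * deriv φ x ∂vol01 :=
        (integral_leftFracInt_mul hν
          (memLp_vol01_of_continuousOn (continuousOn_dirichletSolution hf a₁))
          (integrable_vol01_of_continuousOn hdφ)).symm

theorem ae_eq_leftFracInt_add_const (hu : IsWeakSolution β f a₀ a₁ u) (hβ0 : 0 < β)
    (hβ1 : β < 1) (hf : Integrable f vol01) :
    ∃ c, u =ᵐ[vol01] fun x => leftFracInt (1 - β) (dirichletSolution f a₁) x + c :=
  exists_ae_eq_add_const_of_integral_mul_deriv_eq (hu.1.integrable one_le_two)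
    (integrable_vol01_of_continuousOn
      (continuousOn_leftFracInt (sub_pos.2 hβ1) (continuousOn_dirichletSolution hf a₁)))
    fun _ hφ => hu.integral_mul_deriv hβ0 hβ1 hf hφ

end IsWeakSolution

end CaputoNeumann

theorem mainTheorem11 (β : ℝ) (hβ0 : 0 < β) (hβ1 : β < 1) (f : ℝ → ℝ) (a₀ a₁ : ℝ)
    (hf : MemLp f 2 CaputoNeumann.vol01)
    (hconstraint : (∫ x, f x ∂CaputoNeumann.vol01) + a₁ - a₀ = 0)
    (u : ℝ → ℝ) (hu : CaputoNeumann.IsWeakSolution β f a₀ a₁ u) :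
    ∃ uc w : ℝ → ℝ,
      CaputoNeumann.IsContRep u uc ∧
      CaputoNeumann.IsDirichletSolution f a₀ a₁ w ∧
      (∀ w' : ℝ → ℝ, CaputoNeumann.IsDirichletSolution f a₀ a₁ w' →
        w' =ᵐ[CaputoNeumann.vol01] w) ∧
      ∀ x ∈ Icc (0 : ℝ) 1,
        uc x = CaputoNeumann.leftFracInt (1 - β) w x + uc 0 := by
  have hfi : Integrable f CaputoNeumann.vol01 := hf.integrable one_le_two
  have hcont := CaputoNeumann.continuousOn_leftFracInt (sub_pos.2 hβ1)
    (CaputoNeumann.continuousOn_dirichletSolution hfi a₁)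
  obtain ⟨c, hc⟩ := hu.ae_eq_leftFracInt_add_const hβ0 hβ1 hfi
  refine ⟨_, CaputoNeumann.dirichletSolution f a₁, ⟨hcont.add continuousOn_const, hc⟩,
    CaputoNeumann.isDirichletSolution_dirichletSolution hf hconstraint,
    fun w' hw' => hw'.ae_eq_dirichletSolution hfi hconstraint, fun x _ => ?_⟩
  simp [CaputoNeumann.leftFracInt]
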